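/- Let $G$ be a finite simple graph on a non-empty vertex set $V$ (every such graph is the confusability graph of some classical channel with input alphabet $V$), identified with the operator space $\operatorname{span}\{|i\rangle\langle j| : i=j \text{ or } i\sim j\}$ of complex $V\times V$ matrices. A *cq-graph* with input alphabet $V$ and finite-dimensional output space $B$ is a space $K\subseteq \mathcal L(\mathbb C^V,B)$ that is the linear span of the Kraus operators of a classical-quantum channel $\rho\mapsto\sum_{i\in V}\langle i|\rho|i\rangle\,\sigma_i$, where the $\sigma_i$ are density operators on $B$. With $A=\mathbb C^V$, let $P_{AB}$ be the orthogonal projection onto the span of the Choi vectors $\sum_{i}|i\rangle\otimes E|i\rangle$, $E\in K$ (the support of the Choi–Jamiołkowski matrix of the channel). Put $$\Upsilon(K)=\max\{\operatorname{Tr}S_A : 0\le U_{AB}\le S_A\otimes 1_B,\ \operatorname{Tr}_AU_{AB}=1_B,\ \operatorname{Tr}P_{AB}(S_A\otimes 1_B-U_{AB})=0\},$$ $$\mathsf A(K)=\max\{\operatorname{Tr}S_A : S_A\ge 0,\ \operatorname{Tr}_A P_{AB}(S_A\otimes 1_B)\le 1_B\},$$ let $K^\dagger K=\operatorname{span}\{X^\dagger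 Y: X,Y\in K\}$, and let $$\Upsilon(G)=\min\{\Upsilon(K): K \text{ a cq-graph with } K^\dagger K\subseteq G\}$$ (the minimum running over all finite output dimensions). Let $\vartheta(G)$ be the Lovász number: the minimum of $\max_{i\in V} \langle c,u_i\rangle^{-2}$ over all families of real unit vectors $(u_i)_{i\in V}$, with $u_i\perp u_j$ for distinct non-adjacent $i,j$, and all unit vectors $c$. Let $G_1,G_2$ be finite simple graphs on non-empty vertex sets, and let $G_1\oplus G_2$ be their disjoint union. Then for $k=1,2$ $$\vartheta(G_k)=\min\{\mathsf A(K): K\text{ a cq-graph with }K^\dagger K\subseteq G_k\},$$ the minimum defining $\Upsilon(G_1\oplus G_2)$ is attained, and $$\Upsilon(G_1\oplus G_2)=\vartheta(G_1)+\vartheta(G_2).$$ -/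

import Mathlib

open scoped ComplexOrder Kronecker

noncomputable section

namespace ZeroError

variable {A B : Type*} [Fintype A] [DecidableEq A] [Fintype B] [DecidableEq B]

/-- The partial trace over the first tensor factor. -/
def traceA (M : Matrix (A × B) (A × B) ℂ) : Matrix B B ℂ :=
  Matrix.of fun b b' => ∑ a, M (a, b) (a, b')

/-- The Choi vector `∑ₐ |a⟩ ⊗ E|a⟩` of an operator `E : ℂ^A → ℂ^B`, as a linear map in `E`. -/
def choiVec : Matrix B A ℂ →ₗ[ℂ] EuclideanSpace ℂ (A × B) where
  toFun E := WithLp.toLp 2 fun p => E p.2 p.1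
  map_add' _ _ := rfl
  map_smul' _ _ := rfl

/-- The Choi–Jamiołkowski projection `P_AB` of an operator space `K`: the orthogonal projection onto
the span of the Choi vectors of the operators in `K`. When `K` is spanned by the Kraus operators of
a channel, this is the projection onto the support of the Choi–Jamiołkowski matrix. -/
def choiProjection (K : Submodule ℂ (Matrix B A ℂ)) : Matrix (A × B) (A × B) ℂ :=
  Matrix.toEuclideanCLM (𝕜 := ℂ) (n := A × B) |>.symm (K.map choiVec).starProjection

/-- Feasibility of `(S_A, U_AB)` in the semidefinite program for the one-shot no-signalling assisted
zero-error capacity of `K`. -/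
def UpsilonFeasible (K : Submodule ℂ (Matrix B A ℂ))
    (S : Matrix A A ℂ) (U : Matrix (A × B) (A × B) ℂ) : Prop :=
  U.PosSemidef ∧ (S ⊗ₖ (1 : Matrix B B ℂ) - U).PosSemidef ∧ traceA U = 1 ∧
    (choiProjection K * (S ⊗ₖ (1 : Matrix B B ℂ) - U)).trace = 0

/-- `Υ(K)`, the one-shot no-signalling assisted zero-error classical capacity (as a number of
messages) of a non-commutative bipartite graph `K`. -/
def upsilon (K : Submodule ℂ (Matrix B A ℂ)) : ℝ :=
  sSup {x | ∃ S U, UpsilonFeasible K S U ∧ x = S.trace.re}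

/-- The semidefinite (fractional) packing number of a non-commutative bipartite graph `K`. -/
def packingNumber (K : Submodule ℂ (Matrix B A ℂ)) : ℝ :=
  sSup {x | ∃ S : Matrix A A ℂ, S.PosSemidef ∧
    (1 - traceA (choiProjection K * (S ⊗ₖ (1 : Matrix B B ℂ)))).PosSemidef ∧ x = S.trace.re}

/-- `K` is a cq-graph: the linear span of the Kraus operators `E k` of a classical-quantum channel
`ρ ↦ ∑ₐ ⟨a|ρ|a⟩ σₐ`, where the `σₐ` are density matrices. -/
def IsCQGraph (K : Submodule ℂ (Matrix B A ℂ)) : Prop :=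
  ∃ σ : A → Matrix B B ℂ, (∀ a, (σ a).PosSemidef ∧ (σ a).trace = 1) ∧
    ∃ (n : ℕ) (E : Fin n → Matrix B A ℂ),
      (∀ ρ : Matrix A A ℂ, ∑ k, E k * ρ * (E k).conjTranspose = ∑ a, ρ a a • σ a) ∧
      K = Submodule.span ℂ (Set.range E)

/-- The operator space `K†K`, spanned by the products `X†Y` with `X, Y ∈ K`. -/
def adjointProduct (K : Submodule ℂ (Matrix B A ℂ)) : Submodule ℂ (Matrix A A ℂ) :=
  Submodule.span ℂ {Z | ∃ X ∈ K, ∃ Y ∈ K, Z = X.conjTranspose * Y}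

/-- The operator space of a graph, spanned by the matrix units `|i⟩⟨j|` with `i = j` or `i ~ j`. -/
def graphSpace {V : Type*} [DecidableEq V] (G : SimpleGraph V) : Submodule ℂ (Matrix V V ℂ) :=
  Submodule.span ℂ {Z | ∃ i j, (i = j ∨ G.Adj i j) ∧ Z = Matrix.single i j 1}

section Graph

variable {V : Type*} [Fintype V] [DecidableEq V]

/-- The values `Υ(K)` over all cq-graphs `K`, of any finite output dimension, with `K†K ⊆ G`. -/
def upsilonValues (G : SimpleGraph V) : Set ℝ :=
  {x | ∃ (d : ℕ) (K : Submodule ℂ (Matrix (Fin d) V ℂ)),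
    IsCQGraph K ∧ adjointProduct K ≤ graphSpace G ∧ x = upsilon K}

/-- The semidefinite packing numbers of all cq-graphs `K`, of any finite output dimension, with
`K†K ⊆ G`. -/
def packingValues (G : SimpleGraph V) : Set ℝ :=
  {x | ∃ (d : ℕ) (K : Submodule ℂ (Matrix (Fin d) V ℂ)),
    IsCQGraph K ∧ adjointProduct K ≤ graphSpace G ∧ x = packingNumber K}

/-- `Υ(G)`, the minimum of `Υ(K)` over all cq-graphs `K` with `K†K ⊆ G`. -/
def graphUpsilon (G : SimpleGraph V) : ℝ := sInf (upsilonValues G)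

end Graph

/-- An orthonormal representation of a graph: unit vectors, orthogonal at distinct non-adjacent
vertices. -/
def IsOrthonormalRep {V : Type*} (G : SimpleGraph V) {d : ℕ}
    (u : V → EuclideanSpace ℝ (Fin d)) : Prop :=
  (∀ i, ‖u i‖ = 1) ∧ ∀ i j, i ≠ j → ¬ G.Adj i j → inner ℝ (u i) (u j) = 0

/-- The Lovász number: the minimum, over all orthonormal representations `u` and all unit vectors
`c`, of `maxᵢ 1 / ⟨c, uᵢ⟩²` (pairs with some `⟨c, uᵢ⟩ = 0` have value `∞` and are left out). -/
def lovaszTheta {V : Type*} (G : SimpleGraph V) : ℝ :=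
  sInf {t | ∃ (d : ℕ) (u : V → EuclideanSpace ℝ (Fin d)) (c : EuclideanSpace ℝ (Fin d)),
    IsOrthonormalRep G u ∧ ‖c‖ = 1 ∧ (∀ i, inner ℝ c (u i) ≠ 0) ∧
    t = ⨆ i, 1 / (inner ℝ c (u i)) ^ 2}

end ZeroError

end

/-!
For a cq-graph `K` the Choi projection is block diagonal, `P_AB = ∑ₐ |a⟩⟨a| ⊗ Pₐ`. Hence `A(K)` is
the largest total weight of a fractional packing `∑ₐ sₐ Pₐ ≤ 1`, and `K†K ⊆ G` forces `Pᵢ Pⱼ = 0`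
for distinct non-adjacent `i, j`.

By the minimax theorem, a packing of total weight `ϑ(G)` exists unless some state `ρ = X X†`
satisfies `tr(Pᵢ ρ) > 1 / ϑ(G)` for all `i`; but then the normalised vectors `Pᵢ X`, with handle
`X`, form an orthonormal representation of value less than `ϑ(G)`. Conversely, using the vectors of
an optimal orthonormal representation as pure output states gives a cq-graph in which the handle
bounds the weight of every packing by `ϑ(G)`.

Always `Υ(K) ≤ A(K)`, and `ϑ(G₁ ⊕ G₂) ≤ ϑ(G₁) + ϑ(G₂)`: the orthogonal sum of optimal
representations with values `s`, `t` and handles `c`, `d` has value `s + t` for the handle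
`(√s c, √t d) / √(s + t)`. For the reverse bound, a single projection `Q` separates the two
families of blocks, so the sums `X` and `Y` of optimal packings of the two parts satisfy
`X ≤ 1 - Q` and `Y ≤ Q`. The slack `Q - Y` is orthogonal to the first family and the slack
`1 - Q - X` to the second; as both packings have weight at least `1`, spreading each slack over the
family it is orthogonal to yields a feasible point of the program for `Υ`.
-/

namespace ZeroError

open Matrix
open scoped MatrixOrder

section StarProjection

variable {R : Type*} [Ring R] [StarRing R] [PartialOrder R] [StarOrderedRing R] {p x : R}

theorem mul_le_self_of_commute (hp : IsStarProjection p) (hx : 0 ≤ x) (h : Commute p x) :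
    p * x ≤ x := by
  have conjugate_eq : (1 - p) * x * (1 - p) = x - p * x := by
    rw [mul_assoc, ← ((Commute.one_left x).sub_left h).eq, ← mul_assoc,
      hp.one_sub.isIdempotentElem.eq, sub_mul, one_mul]
  exact sub_nonneg.1 (conjugate_eq ▸ hp.one_sub.isSelfAdjoint.conjugate_nonneg hx)

theorem le_one_sub_of_mul_eq_zero (hp : IsStarProjection p) (hx : x ≤ 1) (hpx : p * x = 0) :
    x ≤ 1 - p := by
  have hx' : IsSelfAdjoint x := by
    simpa using (IsSelfAdjoint.one R).sub (.of_nonneg (sub_nonneg.2 hx))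
  have hxp : x * p = 0 := by
    simpa [hp.isSelfAdjoint.star_eq, hx'.star_eq] using congrArg star hpx
  calc x = (1 - p) * x * (1 - p) := by noncomm_ring [hpx, hxp]
    _ ≤ (1 - p) * 1 * (1 - p) := hp.one_sub.isSelfAdjoint.conjugate_le_conjugate hx
    _ = 1 - p := by rw [mul_one, hp.one_sub.isIdempotentElem.eq]

end StarProjection

section ProjectionMatrix

variable {n : Type*} [Fintype n] [DecidableEq n]

/-- The matrix of the orthogonal projection onto a subspace of `ℂⁿ`. -/
noncomputable def projectionMatrix (F : Submodule ℂ (EuclideanSpace ℂ n)) : Matrix n n ℂ :=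
  toEuclideanCLM (𝕜 := ℂ).symm F.starProjection

theorem isStarProjection_projectionMatrix (F : Submodule ℂ (EuclideanSpace ℂ n)) :
    IsStarProjection (projectionMatrix F) :=
  isStarProjection_starProjection.map (toEuclideanCLM (n := n) (𝕜 := ℂ)).symm

theorem projectionMatrix_mulVec (F : Submodule ℂ (EuclideanSpace ℂ n)) (v : n → ℂ) :
    projectionMatrix F *ᵥ v = (F.starProjection (WithLp.toLp 2 v)).ofLp := by
  rw [← ofLp_toEuclideanCLM (𝕜 := ℂ) (projectionMatrix F) (WithLp.toLp 2 v), projectionMatrix,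
    StarAlgEquiv.apply_symm_apply]

end ProjectionMatrix

section Matrix

variable {𝕜 n : Type*} [RCLike 𝕜] [Fintype n]

theorem mul_eq_zero_of_trace_mul_eq_zero {M N : Matrix n n 𝕜} (hM : 0 ≤ M) (hN : 0 ≤ N)
    (h : (M * N).trace = 0) : M * N = 0 := by
  classical
  obtain ⟨X, rfl⟩ := CStarAlgebra.nonneg_iff_eq_star_mul_self.1 hM
  obtain ⟨Y, rfl⟩ := CStarAlgebra.nonneg_iff_eq_mul_star_self.1 hN
  have hXY : X * Y = 0 := by
    rw [← trace_mul_conjTranspose_self_eq_zero_iff, ← h, conjTranspose_mul, ← mul_assoc,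
      trace_mul_comm]
    simp only [star_eq_conjTranspose, mul_assoc]
  rw [mul_assoc, ← mul_assoc X, hXY, zero_mul, mul_zero]

end Matrix

section ColumnSpace

variable {n m : Type*} [Fintype n] [DecidableEq n] (W : Matrix n m ℂ)

/-- The column space of a matrix, as a subspace of the Euclidean space. -/
def columnSpace : Submodule ℂ (EuclideanSpace ℂ n) :=
  Submodule.span ℂ (Set.range fun j => WithLp.toLp 2 (W.col j))

theorem projectionMatrix_columnSpace_mul : projectionMatrix (columnSpace W) * W = W := by
  have hcol (j : m) : projectionMatrix (columnSpace W) *ᵥ W.col j = W.col j := by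
    have hmem : WithLp.toLp 2 (W.col j) ∈ columnSpace W := Submodule.subset_span ⟨j, rfl⟩
    rw [projectionMatrix_mulVec, Submodule.starProjection_eq_self_iff.2 hmem]
  exact Matrix.ext fun i j => congrFun (hcol j) i

variable [Fintype m]

theorem exists_mul_eq_projectionMatrix_columnSpace :
    ∃ Y : Matrix m n ℂ, W * Y = projectionMatrix (columnSpace W) := by
  have hcol (i : n) : ∃ y : m → ℂ, W *ᵥ y = (projectionMatrix (columnSpace W)).col i := by
    have hmem := Submodule.starProjection_apply_mem (columnSpace W) (WithLp.toLp 2 (Pi.single i 1))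
    obtain ⟨y, hy⟩ := (Submodule.mem_span_range_iff_exists_fun ℂ).1 hmem
    refine ⟨y, ?_⟩
    rw [← mulVec_single_one, projectionMatrix_mulVec, ← hy]
    ext k
    simp [mulVec, dotProduct, mul_comm]
  choose Y hY using hcol
  exact ⟨(of Y)ᵀ, ext_of_mulVec_single fun i => by
    rw [← mulVec_mulVec, mulVec_single_one, mulVec_single_one, ← hY]; rfl⟩

theorem commute_projectionMatrix_columnSpace {D : Matrix n n ℂ} (hD : IsSelfAdjoint D)
    (h : Commute D (W * Wᴴ)) : Commute D (projectionMatrix (columnSpace W)) := by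
  obtain ⟨Y, hY⟩ := exists_mul_eq_projectionMatrix_columnSpace W
  have hPW := projectionMatrix_columnSpace_mul W
  have hP := (isStarProjection_projectionMatrix (columnSpace W)).isSelfAdjoint.star_eq
  set P := projectionMatrix (columnSpace W)
  have hYW : Yᴴ * Wᴴ = P := by rw [← conjTranspose_mul, hY, ← star_eq_conjTranspose, hP]
  have hW : Wᴴ * (1 - P) = 0 := by
    rw [Matrix.mul_sub, Matrix.mul_one, sub_eq_zero]
    simpa [← star_eq_conjTranspose, hP] using congrArg conjTranspose hPW.symm
  have hWD : Wᴴ * (D * (1 - P)) = 0 := by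
    rw [← self_mul_conjTranspose_mul_eq_zero, ← Matrix.mul_assoc, ← h.eq, Matrix.mul_assoc,
      Matrix.mul_assoc, hW, Matrix.mul_zero, Matrix.mul_zero]
  have hPD : P * D = P * D * P := by
    rw [← sub_eq_zero, ← mul_one_sub, mul_assoc]
    nth_rw 1 [← hYW]
    rw [Matrix.mul_assoc, hWD, Matrix.mul_zero]
  have hDP : D * P = P * D * P := by
    simpa [hD.star_eq, hP, mul_assoc] using congrArg star hPD
  exact hDP.trans hPD.symm

theorem exists_isStarProjection_between {ι κ : Type*} [Finite ι] {P : ι → Matrix n n ℂ}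
    {R : κ → Matrix n n ℂ} (hP : ∀ i, IsStarProjection (P i)) (hR : ∀ j, IsStarProjection (R j))
    (hRP : ∀ j i, R j * P i = 0) :
    ∃ Q : Matrix n n ℂ, IsStarProjection Q ∧ (∀ i, P i ≤ Q) ∧ ∀ j, Q ≤ 1 - R j := by
  have := Fintype.ofFinite ι
  let W : Matrix n (ι × n) ℂ := of fun b ik => P ik.1 b ik.2
  have hQ := isStarProjection_projectionMatrix (columnSpace W)
  have hQW := projectionMatrix_columnSpace_mul W
  obtain ⟨Y, hY⟩ := exists_mul_eq_projectionMatrix_columnSpace W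
  refine ⟨projectionMatrix (columnSpace W), hQ, fun i => ?_, fun j => ?_⟩
  · exact (hP i).le_of_mul_eq_right hQ <| Matrix.ext fun b k => congrFun₂ hQW b (i, k)
  · have hRW : R j * W = 0 := Matrix.ext fun b ik => congrFun₂ (hRP j ik.1) b ik.2
    refine le_one_sub_of_mul_eq_zero (hR j) hQ.le_one ?_
    rw [← hY, ← Matrix.mul_assoc, hRW, Matrix.zero_mul]

end ColumnSpace

section Block

variable {A B : Type*}

/-- The diagonal block of an operator on `ℂ^A ⊗ ℂ^B` at a basis vector of `ℂ^A`. -/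
def diagBlock (M : Matrix (A × B) (A × B) ℂ) (a : A) : Matrix B B ℂ :=
  M.submatrix (Prod.mk a) (Prod.mk a)

theorem diagBlock_sub (M N : Matrix (A × B) (A × B) ℂ) (a : A) :
    diagBlock (M - N) a = diagBlock M a - diagBlock N a := rfl

theorem diagBlock_kronecker_one [DecidableEq B] (S : Matrix A A ℂ) (a : A) :
    diagBlock (S ⊗ₖ (1 : Matrix B B ℂ)) a = S a a • (1 : Matrix B B ℂ) := rfl

theorem diagBlock_nonneg {M : Matrix (A × B) (A × B) ℂ} (hM : 0 ≤ M) (a : A) :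
    0 ≤ diagBlock M a :=
  (hM.posSemidef.submatrix _).nonneg

variable [Fintype A]

theorem traceA_eq_sum_diagBlock (M : Matrix (A × B) (A × B) ℂ) :
    traceA M = ∑ a, diagBlock M a := by
  ext b b'
  simp only [traceA, of_apply, Matrix.sum_apply]
  rfl

variable [DecidableEq A]

/-- The block-diagonal operator `∑ₐ |a⟩⟨a| ⊗ Nₐ`, the form of a classical-quantum state. -/
def cqMatrix (N : A → Matrix B B ℂ) : Matrix (A × B) (A × B) ℂ :=
  ∑ a, single a a (1 : ℂ) ⊗ₖ N a

theorem cqMatrix_apply (N : A → Matrix B B ℂ) (p q : A × B) :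
    cqMatrix N p q = if p.1 = q.1 then N p.1 p.2 q.2 else 0 := by
  rw [cqMatrix, Matrix.sum_apply, Finset.sum_eq_single p.1]
  · simp [single_apply]
  · intro a _ ha
    simp [ha]
  · simp

theorem diagBlock_cqMatrix (N : A → Matrix B B ℂ) : diagBlock (cqMatrix N) = N := by
  ext a b b'
  simp [diagBlock, cqMatrix_apply]

variable [Fintype B]

theorem cqMatrix_mul_apply (N : A → Matrix B B ℂ) {m : Type*} (M : Matrix (A × B) m ℂ) (a : A)
    (b : B) (j : m) : (cqMatrix N * M) (a, b) j = ∑ b', N a b b' * M (a, b') j := by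
  simp [Matrix.mul_apply, Fintype.sum_prod_type, cqMatrix_apply, ite_mul]

theorem diagBlock_cqMatrix_mul (N : A → Matrix B B ℂ) (M : Matrix (A × B) (A × B) ℂ) (a : A) :
    diagBlock (cqMatrix N * M) a = N a * diagBlock M a := by
  ext b b'
  exact cqMatrix_mul_apply N M a b (a, b')

theorem cqMatrix_mul_cqMatrix (N M : A → Matrix B B ℂ) :
    cqMatrix N * cqMatrix M = cqMatrix fun a => N a * M a := by
  ext ⟨a, b⟩ ⟨a', b'⟩
  rw [cqMatrix_mul_apply]
  simp only [cqMatrix_apply]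
  split_ifs <;> simp [Matrix.mul_apply]

theorem cqMatrix_nonneg {N : A → Matrix B B ℂ} (hN : ∀ a, 0 ≤ N a) : 0 ≤ cqMatrix N := by
  classical
  refine Finset.sum_nonneg fun a _ => ?_
  rw [← diagonal_single]
  exact ((PosSemidef.diagonal (Pi.single_nonneg.2 zero_le_one)).kronecker (hN a).posSemidef).nonneg

theorem cqMatrix_eq_of_commute [DecidableEq B] {M : Matrix (A × B) (A × B) ℂ}
    (h : ∀ a, Commute (diagonal fun p : A × B => if p.1 = a then (1 : ℂ) else 0) M) :
    M = cqMatrix (diagBlock M) := by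
  ext ⟨a, b⟩ ⟨a', b'⟩
  rw [cqMatrix_apply]
  split_ifs with haa'
  · obtain rfl : a = a' := haa'
    rfl
  · simpa [diagonal_mul, mul_diagonal, Ne.symm haa'] using congrFun₂ (h a).eq (a, b) (a', b')

theorem commute_cqMatrix [DecidableEq B] (N : A → Matrix B B ℂ) (a : A) :
    Commute (diagonal fun p : A × B => if p.1 = a then (1 : ℂ) else 0) (cqMatrix N) := by
  ext p q
  by_cases hpq : p.1 = q.1 <;> simp [diagonal_mul, mul_diagonal, cqMatrix_apply, hpq]

end Block

section Choi

variable {A B : Type*}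

/-- The matrix whose columns are the Choi vectors of the operators `E k`. -/
def choiMatrix {ι : Type*} (E : ι → Matrix B A ℂ) : Matrix (A × B) ι ℂ :=
  of fun p k => E k p.2 p.1

variable [Fintype A] [DecidableEq A]

theorem choiMatrix_mul_conjTranspose {ι : Type*} [Fintype ι] {E : ι → Matrix B A ℂ}
    {σ : A → Matrix B B ℂ}
    (hE : ∀ ρ : Matrix A A ℂ, ∑ k, E k * ρ * (E k)ᴴ = ∑ a, ρ a a • σ a) :
    choiMatrix E * (choiMatrix E)ᴴ = cqMatrix σ := by
  ext ⟨a, b⟩ ⟨a', b'⟩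
  calc (choiMatrix E * (choiMatrix E)ᴴ) (a, b) (a', b')
      = (∑ k, E k * single a a' (1 : ℂ) * (E k)ᴴ : Matrix B B ℂ) b b' := by
        simp [Matrix.mul_apply, Matrix.sum_apply, choiMatrix, single_apply, ite_and]
    _ = ∑ x, (single a a' (1 : ℂ) x x • σ x) b b' := by rw [hE, Matrix.sum_apply]
    _ = cqMatrix σ (a, b) (a', b') := by
        rw [cqMatrix_apply]
        split_ifs with h
        · obtain rfl : a = a' := h
          simp [single_apply]
        · refine Finset.sum_eq_zero fun x _ => ?_
          rw [single_apply, if_neg (by rintro ⟨rfl, rfl⟩; exact h rfl), zero_smul]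
          rfl

variable [Fintype B] [DecidableEq B]

theorem choiProjection_span_range {ι : Type*} (E : ι → Matrix B A ℂ) :
    choiProjection (Submodule.span ℂ (Set.range E)) =
      projectionMatrix (columnSpace (choiMatrix E)) := by
  change projectionMatrix _ = _
  rw [Submodule.map_span, ← Set.range_comp]
  rfl

theorem isStarProjection_choiProjection (K : Submodule ℂ (Matrix B A ℂ)) :
    IsStarProjection (choiProjection K) :=
  isStarProjection_projectionMatrix _

variable {K : Submodule ℂ (Matrix B A ℂ)}

/-- The diagonal blocks of the Choi projection; for a cq-graph, these are the projections onto the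
supports of the output states. -/
noncomputable def choiBlock (K : Submodule ℂ (Matrix B A ℂ)) : A → Matrix B B ℂ :=
  diagBlock (choiProjection K)

theorem IsCQGraph.choiProjection_eq (hK : IsCQGraph K) :
    choiProjection K = cqMatrix (choiBlock K) := by
  obtain ⟨σ, -, n, E, hE, rfl⟩ := hK
  refine cqMatrix_eq_of_commute fun a => ?_
  rw [choiProjection_span_range]
  refine commute_projectionMatrix_columnSpace _ ?_ ?_
  · rw [isSelfAdjoint_iff, star_eq_conjTranspose, diagonal_conjTranspose]
    congr 1
    ext p
    by_cases hp : p.1 = a <;> simp [hp]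
  · rw [choiMatrix_mul_conjTranspose hE]
    exact commute_cqMatrix σ a

theorem IsCQGraph.diagBlock_choiProjection_mul (hK : IsCQGraph K)
    (M : Matrix (A × B) (A × B) ℂ) (a : A) :
    diagBlock (choiProjection K * M) a = choiBlock K a * diagBlock M a := by
  rw [hK.choiProjection_eq, diagBlock_cqMatrix_mul]

theorem IsCQGraph.isStarProjection_choiBlock (hK : IsCQGraph K) (a : A) :
    IsStarProjection (choiBlock K a) where
  isIdempotentElem := by
    refine (hK.diagBlock_choiProjection_mul (choiProjection K) a).symm.trans ?_
    rw [(isStarProjection_choiProjection K).isIdempotentElem.eq]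
    rfl
  isSelfAdjoint := ((isStarProjection_choiProjection K).isSelfAdjoint.isHermitian).submatrix _

theorem IsCQGraph.choiBlock_ne_zero (hK : IsCQGraph K) (a : A) : choiBlock K a ≠ 0 := by
  have hP := hK.choiProjection_eq
  obtain ⟨σ, hσ, n, E, hE, rfl⟩ := hK
  intro hzero
  have hrow (b k) : choiMatrix E (a, b) k = 0 := by
    rw [← projectionMatrix_columnSpace_mul (choiMatrix E), ← choiProjection_span_range, hP,
      cqMatrix_mul_apply, hzero]
    simp
  have hσa : σ a = 0 := by
    rw [← diagBlock_cqMatrix σ, ← choiMatrix_mul_conjTranspose hE]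
    ext b b'
    simp [diagBlock, Matrix.mul_apply, hrow]
  simpa [hσa] using (hσ a).2

theorem column_choiProjection_mem (K : Submodule ℂ (Matrix B A ℂ)) (p : A × B) :
    (of fun b a => choiProjection K (a, b) p) ∈ K := by
  obtain ⟨X, hX, hXp⟩ := Submodule.starProjection_apply_mem (K.map choiVec)
    (WithLp.toLp 2 (Pi.single p 1))
  have hcol : (choiProjection K).col p = (choiVec X).ofLp := by
    rw [hXp, ← projectionMatrix_mulVec, mulVec_single_one]
    rfl
  have hX_eq : (of fun b a => choiProjection K (a, b) p) = X :=
    Matrix.ext fun b a => congrFun hcol (a, b)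
  rwa [hX_eq]

theorem mem_graphSpace_iff {G : SimpleGraph A} {Z : Matrix A A ℂ} :
    Z ∈ graphSpace G ↔ ∀ i j, i ≠ j → ¬ G.Adj i j → Z i j = 0 := by
  constructor
  · intro hZ i j hij hG
    induction hZ using Submodule.span_induction with
    | mem x hx =>
      obtain ⟨i', j', h, rfl⟩ := hx
      rw [single_apply, if_neg]
      rintro ⟨rfl, rfl⟩
      exact h.elim hij hG
    | zero => rfl
    | add x y _ _ hx hy => rw [Matrix.add_apply, hx, hy, add_zero]
    | smul c x _ hx => rw [Matrix.smul_apply, hx, smul_zero]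
  · intro h
    rw [matrix_eq_sum_single Z]
    refine Submodule.sum_mem _ fun i _ => Submodule.sum_mem _ fun j _ => ?_
    by_cases hij : i = j ∨ G.Adj i j
    · rw [← mul_one (Z i j), ← smul_eq_mul, ← smul_single]
      exact Submodule.smul_mem _ _ (Submodule.subset_span ⟨i, j, hij, rfl⟩)
    · push Not at hij
      rw [h i j hij.1 hij.2, single_zero]
      exact Submodule.zero_mem _

theorem choiBlock_mul_choiBlock {G : SimpleGraph A} (hG : adjointProduct K ≤ graphSpace G)
    {a a' : A} (hne : a ≠ a') (hadj : ¬ G.Adj a a') : choiBlock K a * choiBlock K a' = 0 := by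
  have hself : (choiBlock K a)ᴴ = choiBlock K a :=
    (isStarProjection_choiProjection K).isSelfAdjoint.isHermitian.submatrix _
  ext b b'
  rw [← hself]
  exact mem_graphSpace_iff.1 (hG (Submodule.subset_span
    ⟨_, column_choiProjection_mem K (a, b), _, column_choiProjection_mem K (a', b'), rfl⟩))
    a a' hne hadj

end Choi

section Packing

variable {A R : Type*} [Fintype A] [Ring R] [StarRing R] [Algebra ℝ R] [PartialOrder R]
  [StarOrderedRing R]

/-- Weights `s ≥ 0` form a fractional packing of the elements `P` if `∑ₐ sₐ Pₐ ≤ 1`. -/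
def IsPacking (P : A → R) (s : A → ℝ) : Prop :=
  (∀ a, 0 ≤ s a) ∧ ∑ a, s a • P a ≤ 1

theorem IsPacking.smul_le_one [StarModule ℝ R] {P : A → R} {s : A → ℝ} (hs : IsPacking P s)
    (hP : ∀ a, 0 ≤ P a) (a : A) : s a • P a ≤ 1 :=
  (Finset.single_le_sum (fun b _ => smul_nonneg (hs.1 b) (hP b)) (Finset.mem_univ a)).trans hs.2

theorem IsPacking.mono [StarModule ℝ R] {P Q : A → R} {s : A → ℝ} (hs : IsPacking P s)
    (hQP : ∀ a, Q a ≤ P a) : IsPacking Q s :=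
  ⟨hs.1, (Finset.sum_le_sum fun a _ => smul_le_smul_of_nonneg_left (hQP a) (hs.1 a)).trans hs.2⟩

end Packing

section PackingNumber

variable {A B : Type*} [Fintype A] [Fintype B] [DecidableEq B]

theorem IsPacking.le_one {P : A → Matrix B B ℂ} {s : A → ℝ} (hs : IsPacking P s)
    (hP : ∀ a, IsStarProjection (P a)) {a : A} (ha : P a ≠ 0) : s a ≤ 1 := by
  have hle : s a • P a ≤ P a := by
    simpa [(hP a).isIdempotentElem.eq] using (hP a).isSelfAdjoint.conjugate_le_conjugate
      (hs.smul_le_one (fun b => (hP b).nonneg) a)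
  by_contra! hsa
  have hnonpos : (s a - 1) • P a ≤ 0 := by rwa [sub_smul, one_smul, sub_nonpos]
  have hzero := le_antisymm hnonpos (smul_nonneg (sub_nonneg.2 hsa.le) (hP a).nonneg)
  exact ha ((smul_eq_zero.1 hzero).resolve_left (sub_pos.2 hsa).ne')

theorem mul_eq_zero_of_le_smul_one_sub {P D : Matrix B B ℂ} (hP : IsStarProjection P)
    (hD : 0 ≤ D) {r : ℝ} (hDP : D ≤ r • (1 - P)) : P * D = 0 := by
  have hPDP : P * D * P = 0 := by
    refine le_antisymm ?_ (hP.isSelfAdjoint.conjugate_nonneg hD)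
    calc P * D * P ≤ P * (r • (1 - P)) * P := hP.isSelfAdjoint.conjugate_le_conjugate hDP
      _ = 0 := by simp [mul_sub, hP.isIdempotentElem.eq]
  refine mul_eq_zero_of_trace_mul_eq_zero hP.nonneg hD ?_
  rw [← hP.isIdempotentElem.eq, mul_assoc, trace_mul_comm, hPDP, trace_zero]

theorem IsPacking.sum_le {P : A → Matrix B B ℂ} {s : A → ℝ} (hs : IsPacking P s)
    (hP : ∀ a, 0 ≤ P a) {Q : Matrix B B ℂ} (hQ : IsStarProjection Q) (hPQ : ∀ a, P a ≤ Q) :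
    ∑ a, s a • P a ≤ Q := by
  rw [← sub_sub_cancel 1 Q]
  refine le_one_sub_of_mul_eq_zero hQ.one_sub hs.2 ?_
  refine mul_eq_zero_of_le_smul_one_sub hQ.one_sub (r := ∑ a, s a)
    (Finset.sum_nonneg fun a _ => smul_nonneg (hs.1 a) (hP a)) ?_
  rw [sub_sub_cancel, Finset.sum_smul]
  exact Finset.sum_le_sum fun a _ => smul_le_smul_of_nonneg_left (hPQ a) (hs.1 a)

variable [DecidableEq A] {K : Submodule ℂ (Matrix B A ℂ)}

theorem IsCQGraph.traceA_choiProjection_mul (hK : IsCQGraph K) {S : Matrix A A ℂ} (hS : 0 ≤ S) :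
    traceA (choiProjection K * (S ⊗ₖ (1 : Matrix B B ℂ))) =
      ∑ a, (S a a).re • choiBlock K a := by
  simp only [traceA_eq_sum_diagBlock, hK.diagBlock_choiProjection_mul, diagBlock_kronecker_one,
    mul_smul_comm, mul_one]
  refine Finset.sum_congr rfl fun a _ => ?_
  rw [← Complex.coe_smul, ← Complex.eq_re_of_ofReal_le hS.posSemidef.diag_nonneg]

theorem IsCQGraph.packingNumber_eq (hK : IsCQGraph K) :
    packingNumber K = sSup {x | ∃ s, IsPacking (choiBlock K) s ∧ x = ∑ a, s a} := by
  unfold packingNumber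
  congr 1
  ext x
  constructor
  · rintro ⟨S, hS, h, rfl⟩
    rw [hK.traceA_choiProjection_mul hS.nonneg] at h
    refine ⟨fun a => (S a a).re, ⟨fun a => ?_, Matrix.le_iff.2 h⟩, by simp [trace]⟩
    exact (Complex.nonneg_iff.1 hS.diag_nonneg).1
  · rintro ⟨s, hs, rfl⟩
    have hS : (diagonal fun a => (s a : ℂ)).PosSemidef :=
      posSemidef_diagonal_iff.2 fun a => by exact_mod_cast hs.1 a
    refine ⟨_, hS, ?_, by simp [trace]⟩
    simpa [hK.traceA_choiProjection_mul hS.nonneg] using Matrix.le_iff.1 hs.2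

theorem IsCQGraph.le_packingNumber (hK : IsCQGraph K) {s : A → ℝ}
    (hs : IsPacking (choiBlock K) s) : ∑ a, s a ≤ packingNumber K := by
  rw [hK.packingNumber_eq]
  refine le_csSup ⟨Fintype.card A, ?_⟩ ⟨s, hs, rfl⟩
  rintro _ ⟨t, ht, rfl⟩
  calc ∑ a, t a ≤ ∑ _a : A, 1 := Finset.sum_le_sum fun a _ =>
        ht.le_one hK.isStarProjection_choiBlock (hK.choiBlock_ne_zero a)
    _ = Fintype.card A := by simp

theorem IsCQGraph.packingNumber_le (hK : IsCQGraph K) {t : ℝ} (ht : 0 ≤ t)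
    (h : ∀ s, IsPacking (choiBlock K) s → ∑ a, s a ≤ t) : packingNumber K ≤ t := by
  rw [hK.packingNumber_eq]
  refine Real.sSup_le ?_ ht
  rintro _ ⟨s, hs, rfl⟩
  exact h s hs

theorem packingNumber_nonneg (K : Submodule ℂ (Matrix B A ℂ)) : 0 ≤ packingNumber K := by
  refine Real.sSup_nonneg ?_
  rintro _ ⟨S, hS, -, rfl⟩
  exact (Complex.nonneg_iff.1 hS.trace_nonneg).1

end PackingNumber

section Upsilon

variable {A B : Type*} [Fintype A] [DecidableEq A] [Fintype B] [DecidableEq B]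
  {K : Submodule ℂ (Matrix B A ℂ)}

theorem UpsilonFeasible.isPacking {S : Matrix A A ℂ} {U : Matrix (A × B) (A × B) ℂ}
    (h : UpsilonFeasible K S U) (hK : IsCQGraph K) :
    IsPacking (choiBlock K) fun a => (S a a).re := by
  obtain ⟨hU, hSU, hU_trace, horth⟩ := h
  have hzero : choiProjection K * (S ⊗ₖ (1 : Matrix B B ℂ) - U) = 0 :=
    mul_eq_zero_of_trace_mul_eq_zero (isStarProjection_choiProjection K).nonneg hSU.nonneg horth
  have hblock (a : A) : choiBlock K a * (S a a • 1 - diagBlock U a) = 0 := by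
    rw [← diagBlock_kronecker_one, ← diagBlock_sub, ← hK.diagBlock_choiProjection_mul, hzero]
    rfl
  have hS (a : A) : 0 ≤ S a a := by
    obtain ⟨b⟩ : Nonempty B := by
      by_contra hB
      rw [not_nonempty_iff] at hB
      exact hK.choiBlock_ne_zero a (Subsingleton.elim _ _)
    simpa using (hSU.add hU).diag_nonneg (i := (a, b))
  have hcomm (a : A) : Commute (choiBlock K a) (diagBlock U a) := by
    have hP := hK.isStarProjection_choiBlock a
    have hN : IsSelfAdjoint (S a a • 1 - diagBlock U a) :=
      ((IsSelfAdjoint.of_nonneg (hS a)).smul (.one _)).sub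
        (.of_nonneg (diagBlock_nonneg hU.nonneg a))
    have hblock' : (S a a • 1 - diagBlock U a) * choiBlock K a = 0 := by
      simpa [hP.isSelfAdjoint.star_eq, hN.star_eq] using congrArg star (hblock a)
    simpa using ((Commute.one_right (choiBlock K a)).smul_right (S a a)).sub_right
      ((hblock a).trans hblock'.symm : Commute _ _)
  refine ⟨fun a => (Complex.nonneg_iff.1 (hS a)).1, ?_⟩
  calc ∑ a, (S a a).re • choiBlock K a = ∑ a, choiBlock K a * diagBlock U a := by
        refine Finset.sum_congr rfl fun a _ => ?_
        rw [← Complex.coe_smul, ← Complex.eq_re_of_ofReal_le (hS a)]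
        simpa [mul_sub, sub_eq_zero] using hblock a
    _ ≤ ∑ a, diagBlock U a := Finset.sum_le_sum fun a _ =>
        mul_le_self_of_commute (hK.isStarProjection_choiBlock a)
          (diagBlock_nonneg hU.nonneg a) (hcomm a)
    _ = 1 := by rw [← traceA_eq_sum_diagBlock, hU_trace]

theorem IsCQGraph.upsilon_le_packingNumber (hK : IsCQGraph K) : upsilon K ≤ packingNumber K := by
  refine Real.sSup_le ?_ (packingNumber_nonneg K)
  rintro _ ⟨S, U, h, rfl⟩
  simpa [trace] using hK.le_packingNumber (h.isPacking hK)

theorem IsCQGraph.sum_le_upsilon (hK : IsCQGraph K) {s : A → ℝ} {D : A → Matrix B B ℂ}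
    (hs : ∀ a, 0 ≤ s a) (hD : ∀ a, 0 ≤ D a) (hDP : ∀ a, D a ≤ s a • (1 - choiBlock K a))
    (hsum : ∑ a, (s a • choiBlock K a + D a) = 1) : ∑ a, s a ≤ upsilon K := by
  have hP := hK.isStarProjection_choiBlock
  let S : Matrix A A ℂ := diagonal fun a => (s a : ℂ)
  let U := cqMatrix fun a => s a • choiBlock K a + D a
  have hSU : S ⊗ₖ (1 : Matrix B B ℂ) - U =
      cqMatrix fun a => s a • (1 - choiBlock K a) - D a := by
    ext p q
    by_cases hpq : p.1 = q.1 <;> simp [S, U, cqMatrix_apply, hpq, sub_sub, mul_sub]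
  have hfeasible : UpsilonFeasible K S U := by
    refine ⟨(cqMatrix_nonneg fun a => ?_).posSemidef, ?_, ?_, ?_⟩
    · exact add_nonneg (smul_nonneg (hs a) (hP a).nonneg) (hD a)
    · exact hSU ▸ (cqMatrix_nonneg fun a => sub_nonneg.2 (hDP a)).posSemidef
    · rw [traceA_eq_sum_diagBlock, diagBlock_cqMatrix, hsum]
    · have hzero : choiProjection K * (S ⊗ₖ (1 : Matrix B B ℂ) - U) = 0 := by
        have hmul (a : A) : choiBlock K a * (s a • (1 - choiBlock K a) - D a) = 0 := by
          rw [mul_sub, mul_smul_comm, (hP a).mul_one_sub_self, smul_zero,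
            mul_eq_zero_of_le_smul_one_sub (hP a) (hD a) (hDP a), sub_zero]
        rw [hSU, hK.choiProjection_eq, cqMatrix_mul_cqMatrix]
        simp [hmul, cqMatrix]
      rw [hzero, trace_zero]
  refine le_csSup ⟨packingNumber K, ?_⟩ ⟨S, U, hfeasible, by simp [S, trace]⟩
  rintro _ ⟨S, U, h, rfl⟩
  simpa [trace] using hK.le_packingNumber (h.isPacking hK)

variable {V W : Type*} [Fintype V] [DecidableEq V] [Fintype W] [DecidableEq W]

theorem IsCQGraph.add_le_upsilon {K : Submodule ℂ (Matrix B (V ⊕ W) ℂ)} (hK : IsCQGraph K)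
    (horth : ∀ v w, choiBlock K (.inl v) * choiBlock K (.inr w) = 0) {s : V → ℝ} {t : W → ℝ}
    (hs : IsPacking (fun v => choiBlock K (.inl v)) s)
    (ht : IsPacking (fun w => choiBlock K (.inr w)) t)
    (hs_sum : 1 ≤ ∑ v, s v) (ht_sum : 1 ≤ ∑ w, t w) :
    ∑ v, s v + ∑ w, t w ≤ upsilon K := by
  have hP := hK.isStarProjection_choiBlock
  obtain ⟨Q, hQ, hWQ, hQV⟩ := exists_isStarProjection_between (fun w => hP (.inr w))
    (fun v => hP (.inl v)) horth
  let X := ∑ v, s v • choiBlock K (.inl v)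
  let Y := ∑ w, t w • choiBlock K (.inr w)
  have hX_nonneg : 0 ≤ X := Finset.sum_nonneg fun v _ => smul_nonneg (hs.1 v) (hP _).nonneg
  have hY_nonneg : 0 ≤ Y := Finset.sum_nonneg fun w _ => smul_nonneg (ht.1 w) (hP _).nonneg
  have hX : X ≤ 1 - Q :=
    hs.sum_le (fun v => (hP _).nonneg) hQ.one_sub fun v => le_sub_comm.1 (hQV v)
  have hY : Y ≤ Q := ht.sum_le (fun w => (hP _).nonneg) hQ hWQ
  let D : V ⊕ W → Matrix B B ℂ := Sum.elim (fun v => (s v / ∑ v, s v) • (Q - Y))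
    (fun w => (t w / ∑ w, t w) • (1 - Q - X))
  have hD : ∀ a, 0 ≤ D a := by
    rintro (v | w)
    · exact smul_nonneg (div_nonneg (hs.1 v) (zero_le_one.trans hs_sum)) (sub_nonneg.2 hY)
    · exact smul_nonneg (div_nonneg (ht.1 w) (zero_le_one.trans ht_sum)) (sub_nonneg.2 hX)
  have hDP : ∀ a, D a ≤ Sum.elim s t a • (1 - choiBlock K a) := by
    rintro (v | w)
    · exact smul_le_smul' (div_le_self (hs.1 v) hs_sum) ((sub_le_self Q hY_nonneg).trans (hQV v))
        (hs.1 v) (sub_nonneg.2 hY)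
    · exact smul_le_smul' (div_le_self (ht.1 w) ht_sum)
        ((sub_le_self (1 - Q) hX_nonneg).trans (sub_le_sub_left (hWQ w) 1))
        (ht.1 w) (sub_nonneg.2 hX)
  rw [← Fintype.sum_sumElim]
  refine hK.sum_le_upsilon (Sum.rec hs.1 ht.1) hD hDP ?_
  have hs_norm : ∑ v, s v / ∑ v, s v = 1 := by
    rw [← Finset.sum_div, div_self (zero_lt_one.trans_le hs_sum).ne']
  have ht_norm : ∑ w, t w / ∑ w, t w = 1 := by
    rw [← Finset.sum_div, div_self (zero_lt_one.trans_le ht_sum).ne']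
  calc ∑ a, (Sum.elim s t a • choiBlock K a + D a) = X + Y + (Q - Y + (1 - Q - X)) := by
        simp [D, X, Y, Finset.sum_add_distrib, ← Finset.sum_smul, hs_norm, ht_norm]
    _ = 1 := by abel

end Upsilon

section Lovasz

variable {V W E F : Type*} [NormedAddCommGroup E] [InnerProductSpace ℝ E] [NormedAddCommGroup F]
  [InnerProductSpace ℝ F] {G : SimpleGraph V} {H : SimpleGraph W}

theorem exists_euclideanSpace_inner_eq {ι : Type*} [Fintype ι] (x : ι → E) :
    ∃ y : ι → EuclideanSpace ℝ ι, ∀ i j, inner ℝ (y i) (y j) = inner ℝ (x i) (x j) := by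
  classical
  obtain ⟨X, hX⟩ := CStarAlgebra.nonneg_iff_eq_mul_star_self.1 (posSemidef_gram ℝ x).nonneg
  refine ⟨fun i => WithLp.toLp 2 (X i), fun i j => ?_⟩
  have hij : inner ℝ (x i) (x j) = (X * star X) i j := by rw [← hX, gram_apply]
  rw [hij]
  simp [star_eq_conjTranspose, Matrix.mul_apply, PiLp.inner_apply, mul_comm]

/-- An orthonormal representation `u` of a graph in a real inner product space, together with a unit
vector `c`, the *handle* of the representation. -/
def IsHandledRep (G : SimpleGraph V) (u : V → E) (c : E) : Prop :=
  (∀ i, ‖u i‖ = 1) ∧ (∀ i j, i ≠ j → ¬ G.Adj i j → inner ℝ (u i) (u j) = 0) ∧ ‖c‖ = 1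

variable {u : V → E} {c : E}

theorem IsHandledRep.sq_inner_le_one (h : IsHandledRep G u c) (i : V) :
    inner ℝ c (u i) ^ 2 ≤ 1 := by
  simpa [sq_le_one_iff_abs_le_one, h.1 i, h.2.2] using abs_real_inner_le_norm c (u i)

theorem IsHandledRep.of_inner_eq (h : IsHandledRep G u c) {u' : V → F} {c' : F}
    (hu : ∀ i j, inner ℝ (u' i) (u' j) = inner ℝ (u i) (u j)) (hc : inner ℝ c' c' = inner ℝ c c) :
    IsHandledRep G u' c' := by
  refine ⟨fun i => ?_, fun i j hij hadj => (hu i j).trans (h.2.1 i j hij hadj), ?_⟩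
  · rw [norm_eq_sqrt_real_inner, hu, ← norm_eq_sqrt_real_inner, h.1]
  · rw [norm_eq_sqrt_real_inner, hc, ← norm_eq_sqrt_real_inner, h.2.2]

theorem IsHandledRep.exists_euclideanSpace [Fintype V] (h : IsHandledRep G u c) :
    ∃ (u' : V → EuclideanSpace ℝ (Fin (Fintype.card V + 1)))
      (c' : EuclideanSpace ℝ (Fin (Fintype.card V + 1))),
      IsHandledRep G u' c' ∧ ∀ i, inner ℝ c' (u' i) = inner ℝ c (u i) := by
  obtain ⟨y, hy⟩ := exists_euclideanSpace_inner_eq fun o : Option V => o.elim c u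
  let e := LinearIsometryEquiv.piLpCongrLeft 2 ℝ ℝ
    (Fintype.equivFinOfCardEq (Fintype.card_option (α := V)))
  refine ⟨fun i => e (y (some i)), e (y none), h.of_inner_eq (fun i j => ?_) ?_, fun i => ?_⟩ <;>
    rw [e.inner_map_map, hy] <;> rfl

theorem IsHandledRep.lovaszTheta_le [Finite V] (h : IsHandledRep G u c)
    (hne : ∀ i, inner ℝ c (u i) ≠ 0) : lovaszTheta G ≤ ⨆ i, 1 / inner ℝ c (u i) ^ 2 := by
  have := Fintype.ofFinite V
  obtain ⟨u', c', h', hinner⟩ := h.exists_euclideanSpace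
  refine csInf_le ⟨0, ?_⟩ ⟨_, u', c', ⟨h'.1, h'.2.1⟩, h'.2.2, ?_, ?_⟩
  · rintro _ ⟨d, u, c, -, -, -, rfl⟩
    exact Real.iSup_nonneg fun i => by positivity
  · simpa only [hinner] using hne
  · simp only [hinner]

theorem IsHandledRep.exists_sq_inner_mul_lovaszTheta_le_one [Finite V] [Nonempty V]
    (h : IsHandledRep G u c) : ∃ i, inner ℝ c (u i) ^ 2 * lovaszTheta G ≤ 1 := by
  by_cases hne : ∀ i, inner ℝ c (u i) ≠ 0
  · obtain ⟨i, hi⟩ := exists_eq_ciSup_of_finite (f := fun i => 1 / inner ℝ c (u i) ^ 2)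
    have hpos : 0 < inner ℝ c (u i) ^ 2 := by have := hne i; positivity
    exact ⟨i, (le_div_iff₀' hpos).1 ((h.lovaszTheta_le hne).trans_eq hi.symm)⟩
  · push Not at hne
    obtain ⟨i, hi⟩ := hne
    exact ⟨i, by simp [hi]⟩

theorem exists_norm_sq_mul_lovaszTheta_le_one [Finite V] [Nonempty V] (hc : ‖c‖ = 1)
    (hu : ∀ i j, i ≠ j → ¬ G.Adj i j → inner ℝ (u i) (u j) = 0)
    (hcu : ∀ i, inner ℝ c (u i) = ‖u i‖ ^ 2) : ∃ i, ‖u i‖ ^ 2 * lovaszTheta G ≤ 1 := by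
  by_cases hne : ∀ i, ‖u i‖ ≠ 0
  · have hrep : IsHandledRep G (fun i => ‖u i‖⁻¹ • u i) c := by
      refine ⟨fun i => ?_, fun i j hij hadj => ?_, hc⟩
      · rw [norm_smul, norm_inv, norm_norm, inv_mul_cancel₀ (hne i)]
      · rw [real_inner_smul_left, real_inner_smul_right, hu i j hij hadj, mul_zero, mul_zero]
    obtain ⟨i, hi⟩ := hrep.exists_sq_inner_mul_lovaszTheta_le_one
    rw [real_inner_smul_right, hcu, sq ‖u i‖, inv_mul_cancel_left₀ (hne i)] at hi
    exact ⟨i, hi⟩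
  · push Not at hne
    obtain ⟨i, hi⟩ := hne
    exact ⟨i, by simp [hi]⟩

theorem exists_isHandledRep_inner_ne_zero [Fintype V] [Nonempty V] (G : SimpleGraph V) :
    ∃ (u : V → EuclideanSpace ℝ V) (c : EuclideanSpace ℝ V),
      IsHandledRep G u c ∧ ∀ i, inner ℝ c (u i) ≠ 0 := by
  classical
  refine ⟨fun i => EuclideanSpace.single i 1, WithLp.toLp 2 fun _ => (√(Fintype.card V))⁻¹,
    ⟨fun i => by simp, fun i j hij _ => ?_, ?_⟩, fun i => ?_⟩
  · simp [EuclideanSpace.inner_single_left, hij]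
  · simp [EuclideanSpace.norm_eq]
  · simp [EuclideanSpace.inner_single_right]

theorem isCompact_setOf_isHandledRep [ProperSpace E] (G : SimpleGraph V) :
    IsCompact {x : (V → E) × E | IsHandledRep G x.1 x.2} := by
  have hsphere : IsCompact ((Set.univ.pi fun _ : V => Metric.sphere (0 : E) 1) ×ˢ
      Metric.sphere (0 : E) 1) :=
    (isCompact_univ_pi fun _ => isCompact_sphere _ _).prod (isCompact_sphere _ _)
  refine hsphere.of_isClosed_subset ?_ fun x hx => by simpa using ⟨hx.1, hx.2.2⟩
  simp only [IsHandledRep, Set.ofPred_and, Set.ofPred_forall]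
  refine (isClosed_iInter fun i => ?_).inter ((isClosed_iInter fun i => isClosed_iInter fun j =>
    isClosed_iInter fun _ => isClosed_iInter fun _ => ?_).inter ?_) <;>
    exact isClosed_eq (by fun_prop) continuous_const

theorem exists_isHandledRep_forall_sq_inner_le [Finite V] [Nonempty V] [ProperSpace E]
    (h : IsHandledRep G u c) :
    ∃ (u₀ : V → E) (c₀ : E), IsHandledRep G u₀ c₀ ∧ ∀ (u : V → E) (c : E), IsHandledRep G u c →
      ∃ i, ∀ j, inner ℝ c (u i) ^ 2 ≤ inner ℝ c₀ (u₀ j) ^ 2 := by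
  have := Fintype.ofFinite V
  let g : (V → E) × E → ℝ := fun x =>
    Finset.univ.inf' Finset.univ_nonempty fun i => inner ℝ x.2 (x.1 i) ^ 2
  have hg : Continuous g := Continuous.finset_inf'_apply _ fun i _ => by fun_prop
  obtain ⟨⟨u₀, c₀⟩, hrep, hmax⟩ := (isCompact_setOf_isHandledRep G).exists_isMaxOn
    ⟨(u, c), h⟩ hg.continuousOn
  refine ⟨u₀, c₀, hrep, fun u c h => ?_⟩
  obtain ⟨i, -, hi⟩ := Finset.exists_mem_eq_inf' Finset.univ_nonempty
    fun i : V => inner ℝ c (u i) ^ 2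
  exact ⟨i, fun j => hi.symm.trans_le <| (hmax (a := (u, c)) h).trans <|
    Finset.inf'_le _ (Finset.mem_univ j)⟩

theorem one_div_le_lovaszTheta [Fintype V] [Nonempty V] {m : ℝ}
    (h : ∀ (u : V → EuclideanSpace ℝ (Fin (Fintype.card V + 1))) (c), IsHandledRep G u c →
      ∃ i, inner ℝ c (u i) ^ 2 ≤ m) : 1 / m ≤ lovaszTheta G := by
  obtain ⟨u₀, c₀, h₀, hne₀⟩ := exists_isHandledRep_inner_ne_zero G
  obtain ⟨u₁, c₁, h₁, hinner⟩ := h₀.exists_euclideanSpace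
  refine le_csInf ⟨_, _, u₁, c₁, ⟨h₁.1, h₁.2.1⟩, h₁.2.2, fun i => (hinner i).trans_ne (hne₀ i),
    rfl⟩ ?_
  rintro _ ⟨d, u, c, hu, hc, hne, rfl⟩
  obtain ⟨u', c', h', hinner'⟩ :=
    IsHandledRep.exists_euclideanSpace (G := G) (u := u) (c := c) ⟨hu.1, hu.2, hc⟩
  obtain ⟨i, hi⟩ := h u' c' h'
  rw [hinner'] at hi
  have hpos : 0 < inner ℝ c (u i) ^ 2 := by have := hne i; positivity
  exact (one_div_le_one_div_of_le hpos hi).trans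
    (le_ciSup (f := fun i => 1 / inner ℝ c (u i) ^ 2) (Set.finite_range _).bddAbove i)

theorem exists_isHandledRep_one_le_sq_inner_mul_lovaszTheta [Finite V] [Nonempty V]
    (G : SimpleGraph V) :
    ∃ (d : ℕ) (u : V → EuclideanSpace ℝ (Fin d)) (c : EuclideanSpace ℝ (Fin d)),
      IsHandledRep G u c ∧ ∀ i, 1 ≤ inner ℝ c (u i) ^ 2 * lovaszTheta G := by
  have := Fintype.ofFinite V
  obtain ⟨u₀, c₀, h₀, hne₀⟩ := exists_isHandledRep_inner_ne_zero G
  obtain ⟨u₁, c₁, h₁, hinner⟩ := h₀.exists_euclideanSpace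
  obtain ⟨u, c, h, hmax⟩ := exists_isHandledRep_forall_sq_inner_le h₁
  refine ⟨_, u, c, h, fun j => ?_⟩
  have hpos : 0 < inner ℝ c (u j) ^ 2 := by
    obtain ⟨i, hi⟩ := hmax u₁ c₁ h₁
    refine lt_of_lt_of_le ?_ (hi j)
    simpa only [hinner] using sq_pos_of_ne_zero (hne₀ i)
  rw [← div_le_iff₀' hpos]
  exact one_div_le_lovaszTheta fun u' c' h' => (hmax u' c' h').imp fun i hi => hi j

theorem one_le_lovaszTheta [Finite V] [Nonempty V] (G : SimpleGraph V) : 1 ≤ lovaszTheta G := by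
  have := Fintype.ofFinite V
  simpa using one_div_le_lovaszTheta (G := G) (m := 1) fun u c h =>
    ⟨Classical.arbitrary V, h.sq_inner_le_one _⟩

theorem IsHandledRep.sum {u' : W → F} {c' : F} (h : IsHandledRep G u c) (h' : IsHandledRep H u' c')
    {a b : ℝ} (hab : a ^ 2 + b ^ 2 = 1) :
    IsHandledRep (G ⊕g H)
      (Sum.elim (fun i => WithLp.toLp 2 (u i, 0)) (fun j => WithLp.toLp 2 (0, u' j)))
      (WithLp.toLp 2 (a • c, b • c')) := by
  refine ⟨?_, ?_, ?_⟩
  · rintro (i | j)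
    · simp [h.1]
    · simp [h'.1]
  · rintro (i | i) (j | j) hij hadj
    · simpa using h.2.1 i j (by simpa using hij) (by simpa using hadj)
    · simp
    · simp
    · simpa using h'.2.1 i j (by simpa using hij) (by simpa using hadj)
  · simp [WithLp.prod_norm_eq_of_L2, norm_smul, h.2.2, h'.2.2, hab]

theorem lovaszTheta_sum_le [Finite V] [Nonempty V] [Finite W] [Nonempty W]
    (G : SimpleGraph V) (H : SimpleGraph W) :
    lovaszTheta (G ⊕g H) ≤ lovaszTheta G + lovaszTheta H := by
  obtain ⟨_, u, c, h, hu⟩ := exists_isHandledRep_one_le_sq_inner_mul_lovaszTheta G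
  obtain ⟨_, u', c', h', hu'⟩ := exists_isHandledRep_one_le_sq_inner_mul_lovaszTheta H
  have hs := one_le_lovaszTheta G
  have ht := one_le_lovaszTheta H
  have hst := one_le_lovaszTheta (G ⊕g H)
  set s := lovaszTheta G
  set t := lovaszTheta H
  have hs' : √(s / (s + t)) ^ 2 = s / (s + t) := Real.sq_sqrt (by positivity)
  have ht' : √(t / (s + t)) ^ 2 = t / (s + t) := Real.sq_sqrt (by positivity)
  have hbound {x r : ℝ} (hr : 1 ≤ x * r)
      (hle : r / (s + t) * x * lovaszTheta (G ⊕g H) ≤ 1) : lovaszTheta (G ⊕g H) ≤ s + t := by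
    have : x * r * lovaszTheta (G ⊕g H) ≤ s + t := by
      rw [← div_le_one (by positivity)]
      exact hle.trans_eq' (by field_simp)
    nlinarith
  obtain ⟨i | j, hij⟩ := (h.sum h' (a := √(s / (s + t))) (b := √(t / (s + t)))
    (by rw [hs', ht']; field_simp)).exists_sq_inner_mul_lovaszTheta_le_one
  · refine hbound (hu i) ?_
    simpa [real_inner_smul_left, mul_pow, hs'] using hij
  · refine hbound (hu' j) ?_
    simpa [real_inner_smul_left, mul_pow, ht'] using hij

end Lovasz

section Duality

theorem exists_isSaddlePointOn_bilinear {E F : Type*} [AddCommGroup E] [Module ℝ E]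
    [TopologicalSpace E] [IsTopologicalAddGroup E] [ContinuousSMul ℝ E] [T2Space E]
    [FiniteDimensional ℝ E] [AddCommGroup F] [Module ℝ F] [TopologicalSpace F]
    [IsTopologicalAddGroup F] [ContinuousSMul ℝ F] [T2Space F] [FiniteDimensional ℝ F]
    {X : Set E} {Y : Set F} (hX : X.Nonempty) (hX_conv : Convex ℝ X) (hX_comp : IsCompact X)
    (hY : Y.Nonempty) (hY_conv : Convex ℝ Y) (hY_comp : IsCompact Y) (L : E →ₗ[ℝ] F →ₗ[ℝ] ℝ) :
    ∃ a ∈ X, ∃ b ∈ Y, ∀ x ∈ X, ∀ y ∈ Y, L a y ≤ L x b :=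
  Sion.exists_isSaddlePointOn (f := fun x y => L x y) hX hX_conv hX_comp
    (fun y _ => (L.flip y).continuous_of_finiteDimensional.continuousOn.lowerSemicontinuousOn)
    (fun y _ => ((L.flip y).convexOn hX_conv).quasiconvexOn) hY_conv hY hY_comp
    (fun x _ => (L x).continuous_of_finiteDimensional.continuousOn.upperSemicontinuousOn)
    (fun x _ => ((L x).concaveOn hY_conv).quasiconcaveOn)

variable (B : Type*) [Fintype B]

/-- The density matrices on `ℂ^B`, that is, the quantum states. -/
def densityMatrices : Set (Matrix B B ℂ) :=
  {ρ | 0 ≤ ρ ∧ ρ.trace = 1}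

theorem convex_densityMatrices : Convex ℝ (densityMatrices B) := by
  rintro ρ ⟨hρ, hρ_trace⟩ τ ⟨hτ, hτ_trace⟩ a b ha hb hab
  refine ⟨add_nonneg (smul_nonneg ha hρ) (smul_nonneg hb hτ), ?_⟩
  rw [trace_add, trace_smul, trace_smul, hρ_trace, hτ_trace, ← add_smul, hab, one_smul]

variable {B}

theorem star_dotProduct_self_eq_one {v : EuclideanSpace ℂ B} (hv : ‖v‖ = 1) :
    star v.ofLp ⬝ᵥ v.ofLp = 1 := by
  rw [dotProduct_comm, ← EuclideanSpace.inner_eq_star_dotProduct, inner_self_eq_norm_sq_to_K, hv]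
  simp

theorem vecMulVec_star_mem_densityMatrices {v : EuclideanSpace ℂ B} (hv : ‖v‖ = 1) :
    vecMulVec v.ofLp (star v.ofLp) ∈ densityMatrices B := by
  refine ⟨(posSemidef_vecMulVec_self_star _).nonneg, ?_⟩
  rw [trace_vecMulVec, dotProduct_comm, star_dotProduct_self_eq_one hv]

theorem nonempty_densityMatrices [Nonempty B] : (densityMatrices B).Nonempty := by
  classical
  exact ⟨_, vecMulVec_star_mem_densityMatrices
    (v := EuclideanSpace.single (Classical.arbitrary B) 1) (by simp)⟩

theorem real_inner_toLp_vec (X Y : Matrix B B ℂ) :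
    inner ℝ (WithLp.toLp 2 X.vec) (WithLp.toLp 2 Y.vec) = (Xᴴ * Y).trace.re := by
  rw [← star_vec_dotProduct_vec]
  simp [PiLp.inner_apply, dotProduct, Complex.inner, mul_comm, -Complex.mul_re]

theorem mul_conjTranspose_mem_densityMatrices {X : Matrix B B ℂ} :
    X * Xᴴ ∈ densityMatrices B ↔ ‖WithLp.toLp 2 X.vec‖ = 1 := by
  have hnonneg := posSemidef_self_mul_conjTranspose X
  rw [← sq_eq_sq₀ (norm_nonneg _) zero_le_one, one_pow, ← real_inner_self_eq_norm_sq,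
    real_inner_toLp_vec, trace_mul_comm, ← Complex.ofReal_inj,
    ← Complex.eq_re_of_ofReal_le hnonneg.trace_nonneg, Complex.ofReal_one]
  exact and_iff_right hnonneg.nonneg

theorem isCompact_densityMatrices : IsCompact (densityMatrices B) := by
  classical
  let g : EuclideanSpace ℂ (B × B) → Matrix B B ℂ := fun x =>
    (of fun i j => x (j, i)) * (of fun i j => x (j, i))ᴴ
  have hg : Continuous g := by fun_prop
  convert (isCompact_sphere (0 : EuclideanSpace ℂ (B × B)) 1).image hg using 1
  ext ρ
  constructor
  · intro hρ
    obtain ⟨X, rfl⟩ := CStarAlgebra.nonneg_iff_eq_mul_star_self.1 hρ.1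
    exact ⟨WithLp.toLp 2 X.vec, by simpa using mul_conjTranspose_mem_densityMatrices.1 hρ, rfl⟩
  · rintro ⟨x, hx, rfl⟩
    exact mul_conjTranspose_mem_densityMatrices.2 (mem_sphere_zero_iff_norm.1 hx)

theorem le_one_of_forall_mem_densityMatrices [DecidableEq B] {H : Matrix B B ℂ}
    (hH : H.IsHermitian) (h : ∀ ρ ∈ densityMatrices B, (H * ρ).trace.re ≤ 1) : H ≤ 1 := by
  have hH' : (1 - H).IsHermitian := isHermitian_one.sub hH
  rw [Matrix.le_iff, hH'.posSemidef_iff_eigenvalues_nonneg]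
  intro i
  have hρ := vecMulVec_star_mem_densityMatrices (hH'.eigenvectorBasis.orthonormal.1 i)
  have htrace : hH'.eigenvalues i = ((1 - H) * vecMulVec (hH'.eigenvectorBasis i).ofLp
      (star (hH'.eigenvectorBasis i).ofLp)).trace.re := by
    rw [hH'.eigenvalues_eq, mul_vecMulVec, trace_vecMulVec, dotProduct_comm]
    rfl
  rw [Pi.zero_apply, htrace, Matrix.sub_mul, one_mul, trace_sub, hρ.2]
  simpa using h _ hρ

theorem exists_isPacking_sum_eq [DecidableEq B] [Nonempty B] {V : Type*} [Fintype V] [Nonempty V]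
    {P : V → Matrix B B ℂ} (hP : ∀ i, (P i).IsHermitian) {t : ℝ} (ht : 0 ≤ t)
    (h : ∀ ρ ∈ densityMatrices B, ∃ i, t * (P i * ρ).trace.re ≤ 1) :
    ∃ s, IsPacking P s ∧ ∑ i, s i = t := by
  classical
  let L : (V → ℝ) →ₗ[ℝ] Matrix B B ℂ →ₗ[ℝ] ℝ :=
    LinearMap.mk₂ ℝ (fun w ρ => ∑ i, w i * (P i * ρ).trace.re)
      (fun w w' ρ => by simp [add_mul, Finset.sum_add_distrib])
      (fun r w ρ => by simp [mul_assoc, Finset.mul_sum])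
      (fun w ρ ρ' => by simp [mul_add, Finset.sum_add_distrib])
      (fun r w ρ => by simp [mul_left_comm, Finset.mul_sum])
  obtain ⟨w, ⟨hw, hw_sum⟩, ρ, hρ, hsaddle⟩ := exists_isSaddlePointOn_bilinear
    ⟨_, single_mem_stdSimplex ℝ (Classical.arbitrary V)⟩ (convex_stdSimplex ℝ V)
    (isCompact_stdSimplex ℝ V) nonempty_densityMatrices (convex_densityMatrices B)
    isCompact_densityMatrices L
  obtain ⟨i, hi⟩ := h ρ hρ
  refine ⟨t • w, ⟨fun j => mul_nonneg ht (hw j), ?_⟩, by simp [← Finset.mul_sum, hw_sum]⟩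
  refine le_one_of_forall_mem_densityMatrices ?_ fun τ hτ => ?_
  · exact isSelfAdjoint_sum _ fun j _ => (IsSelfAdjoint.all _).smul (hP j)
  · calc ((∑ j, (t • w) j • P j) * τ).trace.re = t * L w τ := by
          simp [L, Matrix.sum_mul, trace_sum, Finset.mul_sum, mul_assoc]
      _ ≤ t * L (Pi.single i 1) ρ := by
          gcongr
          exact hsaddle _ (single_mem_stdSimplex ℝ i) _ hτ
      _ = t * (P i * ρ).trace.re := by simp [L, Pi.single_apply]
      _ ≤ 1 := hi

variable {V : Type*} [Nonempty V] {G : SimpleGraph V}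

theorem exists_lovaszTheta_mul_trace_le_one [Finite V] {P : V → Matrix B B ℂ}
    (hP : ∀ i, IsStarProjection (P i)) (horth : ∀ i j, i ≠ j → ¬ G.Adj i j → P i * P j = 0)
    {ρ : Matrix B B ℂ} (hρ : ρ ∈ densityMatrices B) :
    ∃ i, lovaszTheta G * (P i * ρ).trace.re ≤ 1 := by
  classical
  obtain ⟨X, rfl⟩ := CStarAlgebra.nonneg_iff_eq_mul_star_self.1 hρ.1
  have hmul (i j : V) : (P i * X)ᴴ * (P j * X) = Xᴴ * (P i * P j) * X := by
    rw [conjTranspose_mul, (hP i).isSelfAdjoint.isHermitian.eq]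
    simp only [mul_assoc]
  have hnorm (i : V) : ‖WithLp.toLp 2 (P i * X).vec‖ ^ 2 = (Xᴴ * (P i * X)).trace.re := by
    rw [← real_inner_self_eq_norm_sq, real_inner_toLp_vec, hmul, (hP i).isIdempotentElem.eq,
      mul_assoc]
  obtain ⟨i, hi⟩ := exists_norm_sq_mul_lovaszTheta_le_one (G := G)
    (u := fun i => WithLp.toLp 2 (P i * X).vec) (mul_conjTranspose_mem_densityMatrices.1 hρ)
    (fun i j hij hadj => by rw [real_inner_toLp_vec, hmul, horth i j hij hadj]; simp)
    (fun i => by rw [real_inner_toLp_vec, hnorm])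
  refine ⟨i, ?_⟩
  rwa [hnorm, mul_comm, trace_mul_comm, mul_assoc] at hi

variable [DecidableEq B] [Fintype V]

theorem exists_isPacking_sum_eq_lovaszTheta {P : V → Matrix B B ℂ}
    (hP : ∀ i, IsStarProjection (P i)) (hP_ne : ∀ i, P i ≠ 0)
    (horth : ∀ i j, i ≠ j → ¬ G.Adj i j → P i * P j = 0) :
    ∃ s, IsPacking P s ∧ ∑ i, s i = lovaszTheta G := by
  obtain ⟨b⟩ : Nonempty B := by
    by_contra hB
    rw [not_nonempty_iff] at hB
    exact hP_ne (Classical.arbitrary V) (Subsingleton.elim _ _)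
  have : Nonempty B := ⟨b⟩
  exact exists_isPacking_sum_eq (fun i => (hP i).isSelfAdjoint)
    (zero_le_one.trans (one_le_lovaszTheta G))
    fun ρ hρ => exists_lovaszTheta_mul_trace_le_one hP horth hρ

variable [DecidableEq V]

theorem IsCQGraph.lovaszTheta_le_packingNumber {K : Submodule ℂ (Matrix B V ℂ)}
    (hK : IsCQGraph K) (hG : adjointProduct K ≤ graphSpace G) :
    lovaszTheta G ≤ packingNumber K := by
  obtain ⟨s, hs, hs_sum⟩ := exists_isPacking_sum_eq_lovaszTheta hK.isStarProjection_choiBlock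
    hK.choiBlock_ne_zero fun i j => choiBlock_mul_choiBlock hG
  exact hs_sum ▸ hK.le_packingNumber hs

theorem IsCQGraph.lovaszTheta_add_le_upsilon {W : Type*} [Fintype W] [DecidableEq W] [Nonempty W]
    {H : SimpleGraph W} {K : Submodule ℂ (Matrix B (V ⊕ W) ℂ)} (hK : IsCQGraph K)
    (hG : adjointProduct K ≤ graphSpace (G ⊕g H)) :
    lovaszTheta G + lovaszTheta H ≤ upsilon K := by
  obtain ⟨s, hs, hs_sum⟩ := exists_isPacking_sum_eq_lovaszTheta (G := G)
    (fun v => hK.isStarProjection_choiBlock (.inl v)) (fun v => hK.choiBlock_ne_zero (.inl v))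
    fun i j hij hadj => choiBlock_mul_choiBlock hG (by simpa using hij) (by simpa using hadj)
  obtain ⟨t, ht, ht_sum⟩ := exists_isPacking_sum_eq_lovaszTheta (G := H)
    (fun w => hK.isStarProjection_choiBlock (.inr w)) (fun w => hK.choiBlock_ne_zero (.inr w))
    fun i j hij hadj => choiBlock_mul_choiBlock hG (by simpa using hij) (by simpa using hadj)
  rw [← hs_sum, ← ht_sum]
  refine hK.add_le_upsilon (fun v w => choiBlock_mul_choiBlock hG (by simp) (by simp)) hs ht ?_ ?_
  · exact hs_sum ▸ one_le_lovaszTheta G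
  · exact ht_sum ▸ one_le_lovaszTheta H

end Duality

section RankOne

variable {V B : Type*} [Fintype B]

theorem vecMulVec_star_le {P : Matrix B B ℂ} (hP : IsStarProjection P)
    {v : EuclideanSpace ℂ B} (hv : ‖v‖ = 1) (hPv : P *ᵥ v = v) :
    vecMulVec v.ofLp (star v.ofLp) ≤ P := by
  refine IsStarProjection.le_of_mul_eq_right ⟨?_, ?_⟩ hP ?_
  · rw [IsIdempotentElem, vecMulVec_mul_vecMulVec, star_dotProduct_self_eq_one hv, one_smul]
  · exact (posSemidef_vecMulVec_self_star _).isHermitian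
  · rw [mul_vecMulVec, hPv]

theorem star_dotProduct_vecMulVec_star_mulVec (v c : EuclideanSpace ℂ B) :
    star c.ofLp ⬝ᵥ (vecMulVec v.ofLp (star v.ofLp) *ᵥ c) = ((‖inner ℂ v c‖ ^ 2 : ℝ) : ℂ) := by
  have hvc : star v.ofLp ⬝ᵥ c.ofLp = inner ℂ v c := by
    rw [EuclideanSpace.inner_eq_star_dotProduct, dotProduct_comm]
  have hcv : star c.ofLp ⬝ᵥ v.ofLp = star (inner ℂ v c) := by
    rw [← hvc, star_dotProduct]
  rw [vecMulVec_mulVec, dotProduct_smul, hvc, hcv, Complex.ofReal_pow, ← Complex.conj_mul']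
  rfl

theorem IsPacking.sum_mul_norm_inner_sq_le_one [Fintype V] [DecidableEq B]
    {w : V → EuclideanSpace ℂ B} {s : V → ℝ}
    (hs : IsPacking (fun i => vecMulVec (w i).ofLp (star (w i).ofLp)) s) {c : EuclideanSpace ℂ B}
    (hc : ‖c‖ = 1) : ∑ i, s i * ‖inner ℂ (w i) c‖ ^ 2 ≤ 1 := by
  have hnonneg := (Matrix.le_iff.1 hs.2).dotProduct_mulVec_nonneg c.ofLp
  simp only [sub_mulVec, dotProduct_sub, one_mulVec, star_dotProduct_self_eq_one hc,
    Matrix.sum_mulVec, dotProduct_sum, smul_mulVec, dotProduct_smul,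
    star_dotProduct_vecMulVec_star_mulVec, sub_nonneg, Complex.real_smul] at hnonneg
  exact_mod_cast hnonneg

end RankOne

section PureState

variable {V B : Type*} [DecidableEq V]

/-- The Kraus operators `|wᵢ⟩⟨i|` of the classical-quantum channel with pure output states `wᵢ`. -/
def pureKraus (w : V → EuclideanSpace ℂ B) (i : V) : Matrix B V ℂ :=
  vecMulVec (w i).ofLp (Pi.single i 1)

/-- The cq-graph of the classical-quantum channel with pure output states `wᵢ`. -/
def pureCQGraph (w : V → EuclideanSpace ℂ B) : Submodule ℂ (Matrix B V ℂ) :=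
  Submodule.span ℂ (Set.range (pureKraus w))

variable {w : V → EuclideanSpace ℂ B}

theorem pureKraus_mul_mul_conjTranspose [Fintype V] (w : V → EuclideanSpace ℂ B)
    (ρ : Matrix V V ℂ) (i : V) :
    pureKraus w i * ρ * (pureKraus w i)ᴴ = ρ i i • vecMulVec (w i).ofLp (star (w i).ofLp) := by
  rw [pureKraus, conjTranspose_vecMulVec, vecMulVec_mul, vecMulVec_mul_vecMulVec,
    ← Pi.single_star, star_one, dotProduct_single_one, single_one_vecMul, vecMulVec_smul]
  rfl

variable [Fintype B] [Fintype V]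

theorem isCQGraph_pureCQGraph (hw : ∀ i, ‖w i‖ = 1) : IsCQGraph (pureCQGraph w) := by
  let e := (Fintype.equivFin V).symm
  refine ⟨fun i => vecMulVec (w i).ofLp (star (w i).ofLp), fun i => ?_, _, pureKraus w ∘ e,
    fun ρ => ?_, ?_⟩
  · exact (vecMulVec_star_mem_densityMatrices (hw i)).imp_left LE.le.posSemidef
  · simp only [← pureKraus_mul_mul_conjTranspose w ρ]
    exact e.sum_comp fun i => pureKraus w i * ρ * (pureKraus w i)ᴴ
  · rw [e.surjective.range_comp, pureCQGraph]

theorem adjointProduct_pureCQGraph_le {G : SimpleGraph V}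
    (hw : ∀ i j, i ≠ j → ¬ G.Adj i j → inner ℂ (w i) (w j) = 0) :
    adjointProduct (pureCQGraph w) ≤ graphSpace G := by
  have happly (r : V → ℂ) (b : B) (i : V) : (∑ k, r k • pureKraus w k) b i = r i * w i b := by
    simp [Matrix.sum_apply, pureKraus, vecMulVec_apply, Pi.single_apply]
  refine Submodule.span_le.2 ?_
  rintro _ ⟨X, hX, Y, hY, rfl⟩
  obtain ⟨p, rfl⟩ := (Submodule.mem_span_range_iff_exists_fun ℂ).1 hX
  obtain ⟨q, rfl⟩ := (Submodule.mem_span_range_iff_exists_fun ℂ).1 hY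
  refine mem_graphSpace_iff.2 fun i j hij hadj => ?_
  calc ((∑ k, p k • pureKraus w k)ᴴ * ∑ k, q k • pureKraus w k : Matrix V V ℂ) i j
      = star (p i) * q j * inner ℂ (w i) (w j) := by
        simp only [Matrix.mul_apply, conjTranspose_apply, happly, PiLp.inner_apply,
          Finset.mul_sum, star_mul', RCLike.inner_apply, starRingEnd_apply]
        exact Finset.sum_congr rfl fun b _ => by ring
    _ = 0 := by rw [hw i j hij hadj, mul_zero]

variable [DecidableEq B]

theorem choiBlock_pureCQGraph_mulVec (hw : ∀ i, ‖w i‖ = 1) (i : V) :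
    choiBlock (pureCQGraph w) i *ᵥ w i = w i := by
  ext b
  have h := congrFun₂ (projectionMatrix_columnSpace_mul (choiMatrix (pureKraus w))) (i, b) i
  rw [← choiProjection_span_range, ← pureCQGraph, (isCQGraph_pureCQGraph hw).choiProjection_eq,
    cqMatrix_mul_apply] at h
  simpa [choiMatrix, pureKraus, vecMulVec_apply, mulVec, dotProduct] using h

theorem packingNumber_pureCQGraph_le (hw : ∀ i, ‖w i‖ = 1) {c : EuclideanSpace ℂ B}
    (hc : ‖c‖ = 1) {t : ℝ} (ht : 0 ≤ t) (h : ∀ i, 1 ≤ ‖inner ℂ (w i) c‖ ^ 2 * t) :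
    packingNumber (pureCQGraph w) ≤ t := by
  have hK := isCQGraph_pureCQGraph hw
  refine hK.packingNumber_le ht fun s hs => ?_
  have hs' : IsPacking (fun i => vecMulVec (w i).ofLp (star (w i).ofLp)) s := hs.mono fun i =>
    vecMulVec_star_le (hK.isStarProjection_choiBlock i) (hw i) (choiBlock_pureCQGraph_mulVec hw i)
  calc ∑ i, s i ≤ ∑ i, s i * (‖inner ℂ (w i) c‖ ^ 2 * t) :=
        Finset.sum_le_sum fun i _ => le_mul_of_one_le_right (hs.1 i) (h i)
    _ = (∑ i, s i * ‖inner ℂ (w i) c‖ ^ 2) * t := by simp only [Finset.sum_mul, mul_assoc]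
    _ ≤ t := mul_le_of_le_one_left ht (hs'.sum_mul_norm_inner_sq_le_one hc)

end PureState

section MinimalValues

theorem inner_toLp_ofReal {ι : Type*} [Fintype ι] (x y : EuclideanSpace ℝ ι) :
    inner ℂ (WithLp.toLp 2 fun i => (x i : ℂ)) (WithLp.toLp 2 fun i => (y i : ℂ)) =
      ((inner ℝ x y : ℝ) : ℂ) := by
  simp [PiLp.inner_apply]

theorem norm_toLp_ofReal {ι : Type*} [Fintype ι] (x : EuclideanSpace ℝ ι) :
    ‖WithLp.toLp 2 fun i => (x i : ℂ)‖ = ‖x‖ := by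
  simp [EuclideanSpace.norm_eq]

variable {V W : Type*} [Fintype V] [DecidableEq V] [Nonempty V] [Fintype W] [DecidableEq W]
  [Nonempty W]

theorem exists_isCQGraph_packingNumber_le_lovaszTheta (G : SimpleGraph V) :
    ∃ (d : ℕ) (K : Submodule ℂ (Matrix (Fin d) V ℂ)),
      IsCQGraph K ∧ adjointProduct K ≤ graphSpace G ∧ packingNumber K ≤ lovaszTheta G := by
  obtain ⟨d, u, c, h, hu⟩ := exists_isHandledRep_one_le_sq_inner_mul_lovaszTheta G
  let w (i : V) : EuclideanSpace ℂ (Fin d) := WithLp.toLp 2 fun b => (u i b : ℂ)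
  have hw (i : V) : ‖w i‖ = 1 := (norm_toLp_ofReal (u i)).trans (h.1 i)
  refine ⟨d, pureCQGraph w, isCQGraph_pureCQGraph hw, adjointProduct_pureCQGraph_le
    fun i j hij hadj => ?_, packingNumber_pureCQGraph_le hw ((norm_toLp_ofReal c).trans h.2.2)
    (zero_le_one.trans (one_le_lovaszTheta G)) fun i => ?_⟩
  · rw [inner_toLp_ofReal, h.2.1 i j hij hadj, Complex.ofReal_zero]
  · rw [inner_toLp_ofReal, Complex.norm_real, Real.norm_eq_abs, sq_abs, real_inner_comm]
    exact hu i

theorem isLeast_packingValues (G : SimpleGraph V) :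
    IsLeast (packingValues G) (lovaszTheta G) := by
  constructor
  · obtain ⟨d, K, hK, hG, h⟩ := exists_isCQGraph_packingNumber_le_lovaszTheta G
    exact ⟨d, K, hK, hG, (hK.lovaszTheta_le_packingNumber hG).antisymm h⟩
  · rintro _ ⟨d, K, hK, hG, rfl⟩
    exact hK.lovaszTheta_le_packingNumber hG

theorem isLeast_upsilonValues_sum (G : SimpleGraph V) (H : SimpleGraph W) :
    IsLeast (upsilonValues (G ⊕g H)) (lovaszTheta G + lovaszTheta H) := by
  constructor
  · obtain ⟨d, K, hK, hGH, h⟩ := exists_isCQGraph_packingNumber_le_lovaszTheta (G ⊕g H)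
    exact ⟨d, K, hK, hGH, (hK.lovaszTheta_add_le_upsilon hGH).antisymm
      (hK.upsilon_le_packingNumber.trans (h.trans (lovaszTheta_sum_le G H)))⟩
  · rintro _ ⟨d, K, hK, hGH, rfl⟩
    exact hK.lovaszTheta_add_le_upsilon hGH

end MinimalValues

end ZeroError

theorem mainTheorem9 {V W : Type*} [Fintype V] [DecidableEq V] [Nonempty V]
    [Fintype W] [DecidableEq W] [Nonempty W] (G₁ : SimpleGraph V) (G₂ : SimpleGraph W) :
    IsLeast (ZeroError.packingValues G₁) (ZeroError.lovaszTheta G₁) ∧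
    IsLeast (ZeroError.packingValues G₂) (ZeroError.lovaszTheta G₂) ∧
    IsLeast (ZeroError.upsilonValues (G₁ ⊕g G₂)) (ZeroError.graphUpsilon (G₁ ⊕g G₂)) ∧
    ZeroError.graphUpsilon (G₁ ⊕g G₂) =
      ZeroError.lovaszTheta G₁ + ZeroError.lovaszTheta G₂ := by
  have h := ZeroError.isLeast_upsilonValues_sum G₁ G₂
  have h_eq : ZeroError.graphUpsilon (G₁ ⊕g G₂) =
      ZeroError.lovaszTheta G₁ + ZeroError.lovaszTheta G₂ := h.csInf_eq
  exact ⟨ZeroError.isLeast_packingValues G₁, ZeroError.isLeast_packingValues G₂, h_eq ▸ h, h_eq⟩
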